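/- Let $C=[-\tfrac12,\tfrac12]^3$ be the unit cube in $\mathbb{R}^3$, let $U=(x_1,x_2,x_3)$ be a point of the unit sphere $S^2$, and let $P_U$ be the image of $C$ under the orthogonal projection onto the plane $U^\perp$. Let $mw=mw(U)$ be the mean width of $P_U$ in $U^\perp$, that is, the average over all unit vectors $u\in U^\perp$ of the width of $P_U$ in direction $u$. Then for every $U\in S^2$ $$mw=\frac{2}{\pi}\left(\sqrt{1-x_1^2}+\sqrt{1-x_2^2}+\sqrt{1-x_3^2}\right),$$ and the maximum and the minimum of $mw$ over $S^2$ are $2\sqrt6/\pi$ and $4/\pi$. Write $${}_3F_2(a_1,a_2,a_3;b_1,b_2;z)=\frac{\Gamma(b_1)\Gamma(b_2)}{\Gamma(a_1)\Gamma(a_2)\Gamma(a_3)}\sum_{k=0}^\infty\frac{\Gamma(a_1+k)\Gamma(a_2+k)\Gamma(a_3+k)}{\Gamma(b_1+k)\Gamma(b_2+k)}\frac{z^k}{k!}.$$ If $U$ is uniformly distributed on $S^2$, then $\mathbb{E}(mw)=\tfrac32$ and $$\mathbb{E}(mw^2)=\frac{2}{\pi^2}\left[4+3\pi\,{}_3F_2\left(-\tfrac12,\tfrac12,\tfrac32;1,2;1\right)\right]<1+\frac4\pi,$$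 where the series converges. For $n\ge3$, let $ar_n$ be the surface area (the $(n-2)$-dimensional measure of the boundary) of the orthogonal projection of the unit $n$-cube $[-\tfrac12,\tfrac12]^n$ onto $U^\perp$, where $U$ is uniformly distributed on the unit sphere of $\mathbb{R}^n$, and define the constant $\zeta_n$ by $$\mathbb{E}(ar_n^2)=4(n-1)+(n-2)(n-1)\,\zeta_n+\frac{(n-3)(n-2)(n-1)}{2}\,\pi.$$ Then $\mathbb{E}(ar_3^2)$ is finite, $ar_3$ being the perimeter of $P_U$, and $$\zeta_3=3\pi\,{}_3F_2\left(-\tfrac12,\tfrac12,\tfrac32;1,2;1\right).$$ -/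

import Mathlib

open MeasureTheory Metric
open scoped RealInnerProductSpace

noncomputable section

/-- The uniform probability distribution on the unit sphere of a Euclidean space `V`, that is, the
surface measure of the sphere divided by its total mass. -/
def uniformSphere (V : Type*) [NormedAddCommGroup V] [InnerProductSpace ℝ V]
    [FiniteDimensional ℝ V] [MeasurableSpace V] [BorelSpace V] : Measure (sphere (0 : V) 1) :=
  ((volume : Measure V).toSphere Set.univ)⁻¹ • (volume : Measure V).toSphere

/-- The width of the set `K` in the direction `u`: the distance between the two
supporting hyperplanes of `K` that are orthogonal to the unit vector `u`. -/
def directionalWidth {V : Type*} [NormedAddCommGroup V] [InnerProductSpace ℝ V]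
    (K : Set V) (u : V) : ℝ :=
  sSup ((fun x : V => ⟪u, x⟫) '' K) - sInf ((fun x : V => ⟪u, x⟫) '' K)

/-- The mean width of `K`: the width averaged over all directions in the ambient space `V`. -/
def meanWidth {V : Type*} [NormedAddCommGroup V] [InnerProductSpace ℝ V]
    [FiniteDimensional ℝ V] [MeasurableSpace V] [BorelSpace V] (K : Set V) : ℝ :=
  ∫ u : sphere (0 : V) 1, directionalWidth K (u : V) ∂(uniformSphere V)

/-- The `n`-cube with edges of unit length, centered at the origin. -/
def unitCube (n : ℕ) : Set (EuclideanSpace ℝ (Fin n)) :=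
  {x | ∀ i, |x i| ≤ 1 / 2}

/-- The orthogonal projection of the unit `n`-cube onto the hyperplane of all vectors orthogonal
to the unit vector `U`, as a subset of that `(n - 1)`-dimensional Euclidean space. -/
def projectedCube {n : ℕ} (U : sphere (0 : EuclideanSpace ℝ (Fin n)) 1) :
    Set ((ℝ ∙ (U : EuclideanSpace ℝ (Fin n)))ᗮ : Submodule ℝ (EuclideanSpace ℝ (Fin n))) :=
  ((ℝ ∙ (U : EuclideanSpace ℝ (Fin n)))ᗮ).orthogonalProjectionOnto '' unitCube n

/-- The mean width of the projected cube, computed inside the hyperplane. -/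
def projectedMeanWidth {n : ℕ} (U : sphere (0 : EuclideanSpace ℝ (Fin n)) 1) : ℝ :=
  meanWidth (projectedCube U)

/-- The surface area of the projected cube (`n ≥ 2`): the `(n - 2)`-dimensional Euclidean measure
of its boundary in the hyperplane. For `n = 3` this is the perimeter of a polygon. -/
def projectedSurfaceArea {n : ℕ} (U : sphere (0 : EuclideanSpace ℝ (Fin n)) 1) : ℝ :=
  (Measure.euclideanHausdorffMeasure (n - 2) (frontier (projectedCube U))).toReal

/-- The constant `ζ_n` (`n ≥ 3`), defined by
`E(ar²) = 4 (n - 1) + (n - 2) (n - 1) ζ_n + (n - 3) (n - 2) (n - 1) π / 2`, where `ar` is the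
surface area of the projection of the unit `n`-cube along a uniform random direction. -/
def projectionZeta (n : ℕ) : ℝ :=
  ((∫ U, projectedSurfaceArea U ^ 2 ∂(uniformSphere (EuclideanSpace ℝ (Fin n))))
      - 4 * ((n : ℝ) - 1) - ((n : ℝ) - 3) * ((n : ℝ) - 2) * ((n : ℝ) - 1) / 2 * Real.pi)
    / (((n : ℝ) - 2) * ((n : ℝ) - 1))

/-- The `k`-th term of the series in the definition of `₃F₂`. -/
def hyp32Term (a₁ a₂ a₃ b₁ b₂ z : ℝ) (k : ℕ) : ℝ :=
  Real.Gamma (a₁ + k) * Real.Gamma (a₂ + k) * Real.Gamma (a₃ + k)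
    / (Real.Gamma (b₁ + k) * Real.Gamma (b₂ + k)) * (z ^ k / (k.factorial : ℝ))

/-- The generalized hypergeometric function `₃F₂(a₁, a₂, a₃; b₁, b₂; z)` (for parameters that are
not integers `≤ 0`, where the series converges). -/
def hyp32 (a₁ a₂ a₃ b₁ b₂ z : ℝ) : ℝ :=
  Real.Gamma b₁ * Real.Gamma b₂ / (Real.Gamma a₁ * Real.Gamma a₂ * Real.Gamma a₃)
    * ∑' k : ℕ, hyp32Term a₁ a₂ a₃ b₁ b₂ z k

end

/-! For `u` in `U^⊥` the width of the shadow is `∑ |uᵢ|`, and `uᵢ = ⟪u, P eᵢ⟫` with `P` the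
projection, so `|P eᵢ| = √(1 - xᵢ²)`. On a circle the average of `|⟪u, w⟫|` is `2/π · |w|`, which
gives the mean width. Its extremes follow from `∑ (1 - xᵢ²) = 2`: Cauchy–Schwarz above, `√t ≥ t` on
`[0, 1]` below.

Sphere averages of homogeneous functions are computed by Gaussian integrals over the whole space
(`integral_uniformSphere_of_homogeneous`). In the second moment the diagonal terms add up to the
constant 2. For the six others, `√(1 - xⱼ²)` is expanded in powers of `xⱼ²` and integrated against
`√(1 - xᵢ²)`; the resulting moments are Gamma quotients, and their sum is `π/4` times the `₃F₂`
value (`integral_sphere_sqrt_mul_sqrt`). All terms of that series after the first are `≤ 0`, so a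
partial sum bounds it from above.

For `ζ₃`, when no `xᵢ` vanishes the boundary of the shadow is the injective image of six cube edges,
two in each direction (`frontier_projectedCube`). The perimeter is thus `2 ∑ √(1 - xᵢ²)`, that is,
`π` times the mean width, and `ζ₃` is read off the second moment. -/

/-! ### Gaussian integrals and averages over spheres -/

theorem integral_Ioi_pow_mul_exp_neg_sq (n : ℕ) :
    ∫ r in Set.Ioi (0 : ℝ), r ^ n * Real.exp (-r ^ 2) = Real.Gamma (((n : ℝ) + 1) / 2) / 2 := by
  have h := integral_rpow_mul_exp_neg_rpow (p := 2) (q := n) two_pos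
    (by have := Nat.cast_nonneg (α := ℝ) n; linarith)
  simp only [Real.rpow_natCast, Real.rpow_ofNat] at h
  rw [h]; ring

section Sphere

variable {V : Type*} [NormedAddCommGroup V] [InnerProductSpace ℝ V] [FiniteDimensional ℝ V]
  [MeasurableSpace V] [BorelSpace V]

/-- Polar coordinates: homogeneity separates the integrand, and the radial factor is `∫ r^(n-1+d)
e^(-r²) dr`. -/
theorem integral_mul_exp_neg_norm_sq_eq_toSphere [Nontrivial V] (f : V → ℝ) (d : ℕ)
    (hf : ∀ r : ℝ, 0 < r → ∀ v, f (r • v) = r ^ d * f v) :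
    ∫ v, f v * Real.exp (-‖v‖ ^ 2) =
      (∫ u : sphere (0 : V) 1, f u ∂(volume : Measure V).toSphere) *
        (Real.Gamma (((Module.finrank ℝ V : ℝ) + d) / 2) / 2) := by
  set n := Module.finrank ℝ V with hn
  have hpos : 1 ≤ n := Module.finrank_pos
  calc
    ∫ v, f v * Real.exp (-‖v‖ ^ 2)
      = ∫ x : ({(0)}ᶜ : Set V), f x.1 * Real.exp (-‖x.1‖ ^ 2)
          ∂((volume : Measure V).comap (↑)) := by
      rw [integral_subtype_comap (measurableSet_singleton _).compl
        fun x ↦ f x * Real.exp (-‖x‖ ^ 2), restrict_compl_singleton]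
    _ = ∫ p, f p.1.1 * (p.2.1 ^ d * Real.exp (-p.2.1 ^ 2))
          ∂(volume : Measure V).toSphere.prod (.volumeIoiPow (n - 1)) := by
      rw [← (volume : Measure V).measurePreserving_homeomorphUnitSphereProd.integral_comp
        (Homeomorph.measurableEmbedding _)]
      refine integral_congr_ae (.of_forall fun x => ?_)
      have hx : 0 < ‖x.1‖ := norm_pos_iff.2 x.2
      simp only [homeomorphUnitSphereProd_apply_snd_coe, homeomorphUnitSphereProd_apply_fst_coe]
      have hd : (‖x.1‖⁻¹) ^ d * ‖x.1‖ ^ d = 1 := by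
        rw [← mul_pow, inv_mul_cancel₀ hx.ne', one_pow]
      rw [hf _ (by positivity)]
      linear_combination (-(f x.1 * Real.exp (-‖x.1‖ ^ 2))) * hd
    _ = (∫ u : sphere (0 : V) 1, f u ∂(volume : Measure V).toSphere) *
        ∫ r : Set.Ioi (0 : ℝ), r.1 ^ d * Real.exp (-r.1 ^ 2) ∂.volumeIoiPow (n - 1) :=
      integral_prod_mul (fun u : sphere (0 : V) 1 => f u)
        (fun r : Set.Ioi (0 : ℝ) => r.1 ^ d * Real.exp (-r.1 ^ 2))
    _ = _ := by
      congr 1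
      simp only [Measure.volumeIoiPow, ENNReal.ofReal]
      rw [integral_withDensity_eq_integral_smul
        (measurable_subtype_coe.pow_const _).real_toNNReal,
        integral_subtype_comap measurableSet_Ioi fun a ↦
          Real.toNNReal (a ^ (n - 1)) • (a ^ d * Real.exp (-a ^ 2))]
      have : ((n : ℝ) + d) / 2 = (((n - 1 + d : ℕ) : ℝ) + 1) / 2 := by
        push_cast [Nat.cast_sub hpos]; ring
      rw [this, ← integral_Ioi_pow_mul_exp_neg_sq]
      refine setIntegral_congr_fun measurableSet_Ioi fun x hx => ?_
      simp only [NNReal.smul_def, Real.coe_toNNReal _ (pow_nonneg (le_of_lt hx) _), smul_eq_mul]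
      ring

theorem toSphere_real_univ_mul_Gamma [Nontrivial V] :
    (volume : Measure V).toSphere.real Set.univ * (Real.Gamma ((Module.finrank ℝ V : ℝ) / 2) / 2) =
      Real.pi ^ ((Module.finrank ℝ V : ℝ) / 2) := by
  have h := integral_mul_exp_neg_norm_sq_eq_toSphere (V := V) (fun _ => 1) 0 (by simp)
  have h2 := GaussianFourier.integral_rexp_neg_mul_sq_norm (V := V) one_pos
  simp only [neg_mul, one_mul, div_one] at h2
  simp only [one_mul, h2, integral_const, smul_eq_mul, mul_one, Nat.cast_zero, add_zero] at h
  exact h.symm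

instance isProbabilityMeasure_uniformSphere [Nontrivial V] :
    IsProbabilityMeasure (uniformSphere V) := by
  constructor
  simp only [uniformSphere, Measure.smul_apply, smul_eq_mul]
  exact ENNReal.inv_mul_cancel 
    (Measure.measure_univ_ne_zero.2 (Measure.toSphere_ne_zero _)) (measure_ne_top _ _)

theorem integral_uniformSphere_of_homogeneous [Nontrivial V] (f : V → ℝ) (d : ℕ)
    (hf : ∀ r : ℝ, 0 < r → ∀ v, f (r • v) = r ^ d * f v) :
    ∫ u : sphere (0 : V) 1, f u ∂(uniformSphere V) =
      Real.Gamma ((Module.finrank ℝ V : ℝ) / 2) /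
        (Real.pi ^ ((Module.finrank ℝ V : ℝ) / 2) *
          Real.Gamma (((Module.finrank ℝ V : ℝ) + d) / 2)) *
        ∫ v, f v * Real.exp (-‖v‖ ^ 2) := by
  have hn : (0 : ℝ) < Module.finrank ℝ V := by exact_mod_cast Module.finrank_pos
  have h1 := Real.Gamma_pos_of_pos (half_pos hn)
  have h2 : 0 < Real.Gamma (((Module.finrank ℝ V : ℝ) + d) / 2) :=
    Real.Gamma_pos_of_pos (by positivity)
  have h3 := toSphere_real_univ_mul_Gamma (V := V)
  have h4 : (0 : ℝ) < Real.pi ^ ((Module.finrank ℝ V : ℝ) / 2) := by positivity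
  rw [integral_mul_exp_neg_norm_sq_eq_toSphere f d hf, ← h3]
  rw [← h3] at h4
  have h5 : (volume : Measure V).toSphere.real Set.univ ≠ 0 := by
    intro h; rw [h] at h4; simp at h4
  rw [uniformSphere, integral_smul_measure, ENNReal.toReal_inv, smul_eq_mul]
  change ((volume : Measure V).toSphere.real Set.univ)⁻¹ * _ = _
  field_simp

theorem integral_abs_mul_exp_neg_sq : ∫ x : ℝ, |x| * Real.exp (-x ^ 2) = 1 := by
  have h := integral_comp_abs (f := fun x => x * Real.exp (-x ^ 2))
  simp only [sq_abs] at h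
  have h2 := integral_Ioi_pow_mul_exp_neg_sq 1
  norm_num at h2
  rw [h, h2]; norm_num

theorem integral_exp_neg_sq : ∫ x : ℝ, Real.exp (-x ^ 2) = √Real.pi := by
  simpa using integral_gaussian 1

/-- The average of `|⟪u, w⟫|` over a unit circle. -/
theorem integral_abs_inner_uniformSphere (hV : Module.finrank ℝ V = 2) (w : V) :
    ∫ u : sphere (0 : V) 1, |⟪(u : V), w⟫| ∂(uniformSphere V) = 2 / Real.pi * ‖w‖ := by
  have : Nontrivial V := Module.nontrivial_of_finrank_pos (R := ℝ) (by omega)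
  rcases eq_or_ne w 0 with rfl | hw
  · simp
  have hw' : 0 < ‖w‖ := norm_pos_iff.2 hw
  rw [integral_uniformSphere_of_homogeneous (fun v => |⟪v, w⟫|) 1
    (fun r hr v => by rw [inner_smul_left, abs_mul]; simp [abs_of_pos hr])]
  -- In an orthonormal basis starting with `w / ‖w‖` the inner product is `‖w‖` times the first
  -- coordinate, so the Gaussian integral factors.
  have ho : Orthonormal ℝ (fun i : ({0} : Set (Fin 2)) => ‖w‖⁻¹ • w) := by
    refine ⟨fun i => by simp [norm_smul, hw'.ne'], fun i j hij => ?_⟩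
    exact absurd (Subsingleton.elim i j) hij
  obtain ⟨b, hb⟩ := Orthonormal.exists_orthonormalBasis_extension_of_card_eq (𝕜 := ℝ) (E := V)
    (ι := Fin 2) (by simp [hV]) (v := fun _ => ‖w‖⁻¹ • w) (s := {0}) ho
  have hb0 : b 0 = ‖w‖⁻¹ • w := hb 0 rfl
  have hw0 : w = ‖w‖ • b 0 := by rw [hb0, smul_smul, mul_inv_cancel₀ hw'.ne', one_smul]
  have key : ∫ v, |⟪v, w⟫| * Real.exp (-‖v‖ ^ 2) = ‖w‖ * √Real.pi := by
    rw [← b.measurePreserving_repr_symm.integral_comp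
      b.repr.symm.toHomeomorph.measurableEmbedding]
    rw [← (EuclideanSpace.volume_preserving_symm_measurableEquiv_toLp (Fin 2)).symm.integral_comp
      (MeasurableEquiv.measurableEmbedding _)]
    have := integral_fintype_prod_volume_eq_prod (ι := Fin 2) (E := fun _ => ℝ)
      (fun i x => (if i = 0 then ‖w‖ * |x| else 1) * Real.exp (-x ^ 2))
    simp only [Fin.prod_univ_two, if_true, one_ne_zero, if_false, one_mul] at this
    rw [integral_exp_neg_sq] at this
    simp only [mul_assoc] at this
    have hc : ∫ x : ℝ, ‖w‖ * (|x| * Real.exp (-x ^ 2)) = ‖w‖ := by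
      rw [integral_const_mul, integral_abs_mul_exp_neg_sq, mul_one]
    rw [hc] at this
    rw [← this]
    refine integral_congr_ae (.of_forall fun x => ?_)
    have e1 : ⟪b.repr.symm (WithLp.toLp 2 x), w⟫ = ‖w‖ * x 0 := by
      rw [hw0, inner_smul_right, real_inner_comm, ← b.repr_apply_apply]
      simp [norm_smul]
    have e2 : ‖b.repr.symm (WithLp.toLp 2 x)‖ ^ 2 = x 0 ^ 2 + x 1 ^ 2 := by
      rw [LinearIsometryEquiv.norm_map, EuclideanSpace.norm_sq_eq]; simp
    change |⟪b.repr.symm (WithLp.toLp 2 x), w⟫| * Real.exp (-‖b.repr.symm (WithLp.toLp 2 x)‖ ^ 2)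
      = _
    rw [e1, e2, abs_mul, abs_of_pos hw', neg_add, Real.exp_add]
    ring
  rw [key, hV]
  have h32 : Real.Gamma (((2 : ℕ) + (1 : ℕ) : ℝ) / 2) = √Real.pi / 2 := by
    have : (((2 : ℕ) + (1 : ℕ) : ℝ) / 2) = 1 / 2 + 1 := by norm_num
    rw [this, Real.Gamma_add_one (by norm_num), Real.Gamma_one_half_eq]; ring
  rw [h32]
  have : 0 < √Real.pi := Real.sqrt_pos.2 Real.pi_pos
  norm_num
  field_simp

end Sphere

/-! ### Mixed moments on the 2-sphere -/

theorem Gamma_nat_add_half_succ (k : ℕ) :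
    Real.Gamma (((k + 1 : ℕ) : ℝ) + 1 / 2) = ((k : ℝ) + 1 / 2) * Real.Gamma ((k : ℝ) + 1 / 2) := by
  rw [← Real.Gamma_add_one (by positivity)]
  push_cast; ring_nf

theorem integral_cos_pow_even_neg_pi_pi (k : ℕ) :
    ∫ θ in (-Real.pi)..Real.pi, Real.cos θ ^ (2 * k) =
      2 * √Real.pi * Real.Gamma ((k : ℝ) + 1 / 2) / k.factorial := by
  induction k with
  | zero =>
    have := Real.Gamma_one_half_eq
    simp only [mul_zero, pow_zero, intervalIntegral.integral_const, smul_eq_mul, Nat.cast_zero,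
      zero_add, this, Nat.factorial_zero, Nat.cast_one]
    have := Real.mul_self_sqrt Real.pi_pos.le
    linear_combination (-2 : ℝ) * this
  | succ k ih =>
    rw [show 2 * (k + 1) = 2 * k + 2 by ring, integral_cos_pow, ih, Gamma_nat_add_half_succ,
      Nat.factorial_succ]
    simp only [Real.sin_pi, Real.sin_neg]
    push_cast
    have : (k.factorial : ℝ) ≠ 0 := by positivity
    field_simp
    ring

theorem integral_plane_sqrt_mul_pow (k : ℕ) :
    ∫ p : ℝ × ℝ, √(p.1 ^ 2 + p.2 ^ 2) * p.1 ^ (2 * k) * Real.exp (-(p.1 ^ 2 + p.2 ^ 2)) =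
      √Real.pi * Real.Gamma ((k : ℝ) + 1 / 2) * Real.Gamma ((k : ℝ) + 3 / 2) / k.factorial := by
  rw [← integral_comp_polarCoord_symm, polarCoord_target]
  have h := setIntegral_prod_mul (μ := (volume : Measure ℝ)) (ν := (volume : Measure ℝ))
    (fun r : ℝ => r ^ (2 * k + 2) * Real.exp (-r ^ 2)) (fun θ : ℝ => Real.cos θ ^ (2 * k))
    (Set.Ioi 0) (Set.Ioo (-Real.pi) Real.pi)
  rw [integral_Ioi_pow_mul_exp_neg_sq, ← integral_Ioc_eq_integral_Ioo,
    ← intervalIntegral.integral_of_le (by linarith [Real.pi_pos]),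
    integral_cos_pow_even_neg_pi_pi] at h
  -- The exponent `2k + 2` collects `2k` from the power, one from the square root and one from the
  -- Jacobian.
  have e : (((2 * k + 2 : ℕ) : ℝ) + 1) / 2 = (k : ℝ) + 3 / 2 := by push_cast; ring
  rw [e] at h
  trans Real.Gamma ((k : ℝ) + 3 / 2) / 2 *
    (2 * √Real.pi * Real.Gamma ((k : ℝ) + 1 / 2) / k.factorial)
  · rw [← h]
    refine setIntegral_congr_fun (measurableSet_Ioi.prod measurableSet_Ioo) fun p hp => ?_
    have hp0 : 0 < p.1 := hp.1
    have hs : (p.1 * Real.cos p.2) ^ 2 + (p.1 * Real.sin p.2) ^ 2 = p.1 ^ 2 := by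
      linear_combination p.1 ^ 2 * Real.sin_sq_add_cos_sq p.2
    simp only [polarCoord_symm_apply, smul_eq_mul]
    rw [hs, Real.sqrt_sq hp0.le]
    ring
  · ring

theorem integral_pi_three_eq_prod (g : ℝ → ℝ) (h : ℝ × ℝ → ℝ) :
    ∫ x : Fin 3 → ℝ, g (x 0) * h (x 1, x 2) = (∫ x, g x) * ∫ p, h p := by
  have h1 := volume_preserving_piFinSuccAbove (fun _ : Fin 3 => ℝ) 0
  have h2 := (MeasurePreserving.id (volume : Measure ℝ)).prod (volume_preserving_finTwoArrow ℝ)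
  rw [← integral_prod_mul]
  have h3 := (h2.comp h1).integral_comp
    ((MeasurableEquiv.prodCongr (MeasurableEquiv.refl ℝ)
      (MeasurableEquiv.finTwoArrow (α := ℝ))).measurableEmbedding.comp
      (MeasurableEquiv.piFinSuccAbove (fun _ : Fin 3 => ℝ) 0).measurableEmbedding)
    (fun z : ℝ × (ℝ × ℝ) => g z.1 * h z.2)
  exact h3

theorem integral_euclideanSpace_three_eq_pi (F : EuclideanSpace ℝ (Fin 3) → ℝ) :
    ∫ v, F v = ∫ x : Fin 3 → ℝ, F (WithLp.toLp 2 x) :=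
  ((EuclideanSpace.volume_preserving_symm_measurableEquiv_toLp (Fin 3)).symm.integral_comp
      (MeasurableEquiv.measurableEmbedding _) F).symm

theorem exists_perm_fin_three {i j : Fin 3} (hij : i ≠ j) :
    ∃ σ : Equiv.Perm (Fin 3), σ i = 0 ∧ σ j = 1 := by
  revert i j; decide

/-- The square root involves only the two coordinates other than `i`, so the `i`-th splits off as a
one-dimensional Gaussian and a plane integral remains. A permutation reduces to `i = 0`, `j = 1`. -/
theorem integral_gaussian_sqrt_mul_pow {i j : Fin 3} (hij : i ≠ j) (k : ℕ) :
    ∫ v : EuclideanSpace ℝ (Fin 3),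
      √(‖v‖ ^ 2 - v i ^ 2) * v j ^ (2 * k) * Real.exp (-‖v‖ ^ 2) =
      Real.pi * Real.Gamma ((k : ℝ) + 1 / 2) * Real.Gamma ((k : ℝ) + 3 / 2) / k.factorial := by
  obtain ⟨σ, hi, hj⟩ := exists_perm_fin_three hij
  have hm := (LinearIsometryEquiv.piLpCongrLeft 2 ℝ ℝ σ.symm).measurePreserving
  rw [← hm.integral_comp 
      (LinearIsometryEquiv.piLpCongrLeft 2 ℝ ℝ σ.symm).toHomeomorph.measurableEmbedding,
    integral_euclideanSpace_three_eq_pi]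
  have h := integral_pi_three_eq_prod (fun x => Real.exp (-x ^ 2))
    (fun p => √(p.1 ^ 2 + p.2 ^ 2) * p.1 ^ (2 * k) * Real.exp (-(p.1 ^ 2 + p.2 ^ 2)))
  rw [integral_exp_neg_sq, integral_plane_sqrt_mul_pow] at h
  trans √Real.pi * (√Real.pi * Real.Gamma ((k : ℝ) + 1 / 2) * Real.Gamma ((k : ℝ) + 3 / 2) /
    k.factorial)
  · rw [← h]
    refine integral_congr_ae (.of_forall fun x => ?_)
    have ei : LinearIsometryEquiv.piLpCongrLeft 2 ℝ ℝ σ.symm (WithLp.toLp 2 x) i = x 0 := by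
      simp [LinearIsometryEquiv.piLpCongrLeft_apply, Equiv.piCongrLeft', hi]
    have ej : LinearIsometryEquiv.piLpCongrLeft 2 ℝ ℝ σ.symm (WithLp.toLp 2 x) j = x 1 := by
      simp [LinearIsometryEquiv.piLpCongrLeft_apply, Equiv.piCongrLeft', hj]
    have en : ‖WithLp.toLp 2 x‖ ^ 2 = x 0 ^ 2 + (x 1 ^ 2 + x 2 ^ 2) := by
      rw [EuclideanSpace.norm_sq_eq]; simp [Fin.sum_univ_three]; ring
    simp only [LinearIsometryEquiv.norm_map, ei, ej, en]
    rw [add_sub_cancel_left, neg_add, Real.exp_add]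
    ring
  · have := Real.mul_self_sqrt Real.pi_pos.le
    linear_combination (Real.Gamma ((k : ℝ) + 1 / 2) * Real.Gamma ((k : ℝ) + 3 / 2) /
      k.factorial) * this

/-- The mixed moment `E(√(1 - xᵢ²) xⱼ^(2k))` of a uniform random point of the sphere `S²`. -/
theorem integral_sphere_sqrt_mul_pow {i j : Fin 3} (hij : i ≠ j) (k : ℕ) :
    ∫ U : sphere (0 : EuclideanSpace ℝ (Fin 3)) 1,
      √(1 - (U : EuclideanSpace ℝ (Fin 3)) i ^ 2) * (U : EuclideanSpace ℝ (Fin 3)) j ^ (2 * k)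
        ∂(uniformSphere (EuclideanSpace ℝ (Fin 3))) =
      Real.Gamma ((k : ℝ) + 1 / 2) * Real.Gamma ((k : ℝ) + 3 / 2) /
        (2 * Real.Gamma (2 + k) * k.factorial) := by
  -- Replacing `1` by `‖v‖²` changes nothing on the sphere and makes the function homogeneous of
  -- degree `2k + 1`.
  have h := integral_uniformSphere_of_homogeneous
    (fun v : EuclideanSpace ℝ (Fin 3) => √(‖v‖ ^ 2 - v i ^ 2) * v j ^ (2 * k)) (2 * k + 1)
    (fun r hr v => by
      have : ‖r • v‖ ^ 2 - (r • v) i ^ 2 = r ^ 2 * (‖v‖ ^ 2 - v i ^ 2) := by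
        simp only [norm_smul, PiLp.smul_apply, smul_eq_mul, mul_pow, Real.norm_eq_abs, sq_abs]
        ring
      rw [this, Real.sqrt_mul (sq_nonneg r), Real.sqrt_sq hr.le]
      simp only [PiLp.smul_apply, smul_eq_mul]
      ring)
  rw [integral_gaussian_sqrt_mul_pow hij] at h
  simp only [norm_eq_of_mem_sphere, one_pow, finrank_euclideanSpace, Fintype.card_fin] at h
  rw [h]
  have e1 : ((3 : ℕ) : ℝ) / 2 = 1 / 2 + 1 := by norm_num
  have e2 : (((3 : ℕ) : ℝ) + ((2 * k + 1 : ℕ) : ℝ)) / 2 = 2 + k := by push_cast; ring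
  have hG : 0 < Real.Gamma (2 + (k : ℝ)) := Real.Gamma_pos_of_pos (by positivity)
  have hp : 0 < √Real.pi := Real.sqrt_pos.2 Real.pi_pos
  rw [e2, e1, Real.Gamma_add_one (by norm_num), Real.Gamma_one_half_eq,
    Real.rpow_add Real.pi_pos, ← Real.sqrt_eq_rpow, Real.rpow_one]
  have := Real.pi_pos
  field_simp

/-- The first moment `E √(1 - xᵢ²) = π / 4`. -/
theorem integral_sphere_sqrt (i : Fin 3) :
    ∫ U : sphere (0 : EuclideanSpace ℝ (Fin 3)) 1,
      √(1 - (U : EuclideanSpace ℝ (Fin 3)) i ^ 2) ∂(uniformSphere (EuclideanSpace ℝ (Fin 3))) =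
      Real.pi / 4 := by
  obtain ⟨j, hj⟩ := exists_ne i
  have h := integral_sphere_sqrt_mul_pow hj.symm 0
  simp only [mul_zero, pow_zero, mul_one, Nat.cast_zero, zero_add, add_zero] at h
  rw [h, show (3 / 2 : ℝ) = 1 / 2 + 1 by norm_num, Real.Gamma_add_one (by norm_num),
    Real.Gamma_one_half_eq, Real.Gamma_two]
  have := Real.mul_self_sqrt Real.pi_pos.le
  simp only [Nat.factorial_zero, Nat.cast_one]
  linear_combination this / 4

/-! ### The binomial series of the square root -/

/-- The coefficients of the power series of `√(1 - s)`. -/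
noncomputable def sqrtCoeff (k : ℕ) : ℝ :=
  Real.Gamma (-1 / 2 + k) / (Real.Gamma (-1 / 2) * k.factorial)

theorem neg_half_add_nat_ne_neg_nat (k m : ℕ) : (-1 / 2 + k : ℝ) ≠ -m := by
  intro h
  have h2 : (2 * (k + m) : ℝ) = 1 := by linarith
  have h3 : 2 * (k + m) = 1 := by exact_mod_cast h2
  omega

theorem Gamma_neg_half_add_nat_ne_zero (k : ℕ) : Real.Gamma (-1 / 2 + k) ≠ 0 :=
  Real.Gamma_ne_zero (neg_half_add_nat_ne_neg_nat k)

theorem Gamma_neg_half_ne_zero : Real.Gamma (-1 / 2) ≠ 0 := by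
  simpa using Gamma_neg_half_add_nat_ne_zero 0

theorem Gamma_neg_half_add_nat_succ (k : ℕ) :
    Real.Gamma (-1 / 2 + (k + 1 : ℕ)) = (-1 / 2 + k) * Real.Gamma (-1 / 2 + k) := by
  rw [← Real.Gamma_add_one (by simpa using neg_half_add_nat_ne_neg_nat k 0)]
  push_cast; ring_nf

theorem sqrtCoeff_zero : sqrtCoeff 0 = 1 := by
  simp [sqrtCoeff, Gamma_neg_half_ne_zero]

theorem sqrtCoeff_succ (k : ℕ) :
    sqrtCoeff (k + 1) = sqrtCoeff k * (-1 / 2 + k) / (k + 1) := by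
  have h1 := Gamma_neg_half_ne_zero
  have h2 : (k.factorial : ℝ) ≠ 0 := by positivity
  rw [sqrtCoeff, sqrtCoeff, Gamma_neg_half_add_nat_succ, Nat.factorial_succ]
  push_cast
  field_simp

theorem sqrtCoeff_succ_nonpos (k : ℕ) : sqrtCoeff (k + 1) ≤ 0 := by
  induction k with
  | zero => rw [sqrtCoeff_succ, sqrtCoeff_zero]; norm_num
  | succ k ih =>
    rw [sqrtCoeff_succ]
    refine div_nonpos_of_nonpos_of_nonneg (mul_nonpos_of_nonpos_of_nonneg ih ?_) (by positivity)
    push_cast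
    have : (0 : ℝ) ≤ k := by positivity
    linarith

/-- Since the coefficients after the first are `≤ 0`, this closed form shows that the partial sums
stay `≥ 0`. The absolute values of those coefficients therefore sum to at most 1, so the series
converges absolutely even at `s = 1`. -/
theorem sum_range_sqrtCoeff (n : ℕ) :
    ∑ k ∈ Finset.range (n + 1), sqrtCoeff k = -2 * (n + 1) * sqrtCoeff (n + 1) := by
  induction n with
  | zero => rw [sqrtCoeff_succ]; simp [sqrtCoeff_zero]; norm_num
  | succ n ih =>
    rw [Finset.sum_range_succ, ih, sqrtCoeff_succ (n + 1)]
    push_cast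
    field_simp
    ring

theorem summable_sqrtCoeff : Summable sqrtCoeff := by
  rw [← summable_nat_add_iff 1, ← summable_neg_iff]
  refine summable_of_sum_range_le (c := 1) (fun k => neg_nonneg.2 (sqrtCoeff_succ_nonpos k))
    fun n => ?_
  have h := sum_range_sqrtCoeff n
  rw [Finset.sum_range_succ', sqrtCoeff_zero] at h
  simp only [Finset.sum_neg_distrib]
  have : 0 ≤ -2 * ((n : ℝ) + 1) * sqrtCoeff (n + 1) :=
    mul_nonneg_of_nonpos_of_nonpos (by have : (0 : ℝ) ≤ n := by positivity
                                       linarith) (sqrtCoeff_succ_nonpos n)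
  linarith

theorem choose_eq_sqrtCoeff (k : ℕ) :
    Ring.choose (-1 / 2 + (k : ℝ) - 1) k = sqrtCoeff k := by
  have hP : ∀ k : ℕ, (ascPochhammer ℝ k).eval (-1 / 2) * Real.Gamma (-1 / 2) =
      Real.Gamma (-1 / 2 + k) := by
    intro k
    induction k with
    | zero => simp
    | succ k ih =>
      rw [ascPochhammer_succ_eval, Gamma_neg_half_add_nat_succ, ← ih]
      ring
  rw [← Ring.multichoose_eq, sqrtCoeff, ← hP]
  have h := Ring.factorial_nsmul_multichoose_eq_ascPochhammer (-1 / 2 : ℝ) k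
  rw [Polynomial.ascPochhammer_smeval_eq_eval, nsmul_eq_mul] at h
  rw [← h]
  have h1 := Gamma_neg_half_ne_zero
  have h2 : (k.factorial : ℝ) ≠ 0 := by positivity
  generalize Real.Gamma (-1 / 2) = g at *
  field_simp

theorem hasSum_sqrtCoeff_mul_pow {s : ℝ} (h0 : 0 ≤ s) (h1 : s < 1) :
    HasSum (fun k => sqrtCoeff k * s ^ k) √(1 - s) := by
  have h := (Real.one_div_one_sub_rpow_hasFPowerSeriesOnBall_zero (-1 / 2)).hasSum (y := s)
    (by simp [enorm_eq_nnnorm, ← NNReal.coe_lt_coe, abs_of_nonneg h0, h1])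
  simp only [FormalMultilinearSeries.ofScalars_apply_eq, choose_eq_sqrtCoeff, smul_eq_mul,
    zero_add] at h
  have e : √(1 - s) = 1 / (1 - s) ^ (-1 / 2 : ℝ) := by
    rw [Real.sqrt_eq_rpow, one_div (((1 - s) ^ _ : ℝ)), ← Real.rpow_neg (by linarith)]
    norm_num
  rwa [e]

/-! ### The moment series and its hypergeometric form -/

-- The cone over a coordinate great subsphere lies in a hyperplane, hence has volume zero. This null
-- set is discarded twice: for the convergence of the series and for the shape of the shadow's
-- boundary.
open scoped Pointwise in
theorem uniformSphere_ae_coord_ne_zero {n : ℕ} :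
    ∀ᵐ U : sphere (0 : EuclideanSpace ℝ (Fin n)) 1 ∂(uniformSphere (EuclideanSpace ℝ (Fin n))),
      ∀ i, (U : EuclideanSpace ℝ (Fin n)) i ≠ 0 := by
  rw [ae_all_iff]
  intro i
  refine Measure.ae_smul_measure ?_ _
  rw [ae_iff]
  simp only [not_not]
  have hm : MeasurableSet {U : sphere (0 : EuclideanSpace ℝ (Fin n)) 1 |
      (U : EuclideanSpace ℝ (Fin n)) i = 0} :=
    (isClosed_eq (by fun_prop) continuous_const).measurableSet
  rw [Measure.toSphere_apply' _ hm]
  have hsub : Set.Ioo (0 : ℝ) 1 • ((↑) '' {U : sphere (0 : EuclideanSpace ℝ (Fin n)) 1 |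
      (U : EuclideanSpace ℝ (Fin n)) i = 0} : Set (EuclideanSpace ℝ (Fin n))) ⊆
      (LinearMap.ker (EuclideanSpace.proj (𝕜 := ℝ) i :
        EuclideanSpace ℝ (Fin n) →L[ℝ] ℝ).toLinearMap :
        Set (EuclideanSpace ℝ (Fin n))) := by
    rintro _ ⟨r, -, _, ⟨U, hU, rfl⟩, rfl⟩
    have hU' : (U : EuclideanSpace ℝ (Fin n)) i = 0 := hU
    simp [hU']
  have h0 := Measure.addHaar_submodule (volume : Measure (EuclideanSpace ℝ (Fin n)))
    (LinearMap.ker (EuclideanSpace.proj (𝕜 := ℝ) i :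
        EuclideanSpace ℝ (Fin n) →L[ℝ] ℝ).toLinearMap) (by
      rw [Ne, LinearMap.ker_eq_top]
      intro h
      have := LinearMap.congr_fun h (EuclideanSpace.single i 1)
      simp at this)
  rw [measure_mono_null hsub h0, mul_zero]

theorem sq_coord_le_one {n : ℕ} (U : sphere (0 : EuclideanSpace ℝ (Fin n)) 1) (i : Fin n) :
    (U : EuclideanSpace ℝ (Fin n)) i ^ 2 ≤ 1 := by
  have h := PiLp.norm_apply_le (U : EuclideanSpace ℝ (Fin n)) i
  rw [norm_eq_of_mem_sphere] at h
  rw [← sq_abs]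
  exact pow_le_one₀ (abs_nonneg _) h

theorem sum_sq_coord_eq_one {n : ℕ} (U : sphere (0 : EuclideanSpace ℝ (Fin n)) 1) :
    ∑ i, (U : EuclideanSpace ℝ (Fin n)) i ^ 2 = 1 := by
  rw [← EuclideanSpace.real_norm_sq_eq, norm_eq_of_mem_sphere, one_pow]

/-- Termwise integration, dominated by the summable constants `|sqrtCoeff k|`. The expansion needs
`xⱼ² < 1`, which holds as soon as `xᵢ ≠ 0`. -/
theorem hasSum_integral_sphere_sqrt_mul_sqrt {i j : Fin 3} (hij : i ≠ j) :
    HasSum (fun k : ℕ => sqrtCoeff k * (Real.Gamma ((k : ℝ) + 1 / 2) *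
        Real.Gamma ((k : ℝ) + 3 / 2) / (2 * Real.Gamma (2 + k) * k.factorial)))
      (∫ U : sphere (0 : EuclideanSpace ℝ (Fin 3)) 1,
        √(1 - (U : EuclideanSpace ℝ (Fin 3)) i ^ 2) * √(1 - (U : EuclideanSpace ℝ (Fin 3)) j ^ 2)
        ∂(uniformSphere (EuclideanSpace ℝ (Fin 3)))) := by
  have h := hasSum_integral_of_dominated_convergence
    (μ := uniformSphere (EuclideanSpace ℝ (Fin 3)))
    (F := fun (k : ℕ) (U : sphere (0 : EuclideanSpace ℝ (Fin 3)) 1) =>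
      sqrtCoeff k * (√(1 - (U : EuclideanSpace ℝ (Fin 3)) i ^ 2) *
        (U : EuclideanSpace ℝ (Fin 3)) j ^ (2 * k)))
    (f := fun U => √(1 - (U : EuclideanSpace ℝ (Fin 3)) i ^ 2) *
      √(1 - (U : EuclideanSpace ℝ (Fin 3)) j ^ 2))
    (fun k _ => |sqrtCoeff k|) (fun k => by fun_prop) ?_ ?_ ?_ ?_
  · simpa only [integral_const_mul, integral_sphere_sqrt_mul_pow hij] using h
  · refine fun k => .of_forall fun U => ?_
    rw [norm_mul, norm_mul, Real.norm_eq_abs]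
    refine mul_le_of_le_one_right (abs_nonneg _) (mul_le_one₀ ?_ (norm_nonneg _) ?_)
    · rw [Real.norm_of_nonneg (Real.sqrt_nonneg _), Real.sqrt_le_one]
      linarith [sq_nonneg ((U : EuclideanSpace ℝ (Fin 3)) i)]
    · rw [pow_mul, Real.norm_of_nonneg (by positivity)]
      exact pow_le_one₀ (sq_nonneg _) (sq_coord_le_one U j)
  · exact .of_forall fun _ => summable_sqrtCoeff.abs
  · exact integrable_const _
  · filter_upwards [uniformSphere_ae_coord_ne_zero] with U hU
    have hlt : (U : EuclideanSpace ℝ (Fin 3)) j ^ 2 < 1 := by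
      refine lt_of_lt_of_eq ?_ (sum_sq_coord_eq_one U)
      refine Finset.single_lt_sum (j := i) hij (Finset.mem_univ _) (Finset.mem_univ _)
        (by have := hU i; positivity) (fun _ _ _ => sq_nonneg _)
    have h := (hasSum_sqrtCoeff_mul_pow (sq_nonneg _) hlt).mul_left
      √(1 - (U : EuclideanSpace ℝ (Fin 3)) i ^ 2)
    refine h.congr_fun fun k => ?_
    rw [pow_mul]; ring

theorem hyp32Term_eq_sqrtCoeff_mul (k : ℕ) :
    hyp32Term (-1 / 2) (1 / 2) (3 / 2) 1 2 1 k = 2 * Real.Gamma (-1 / 2) *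
      (sqrtCoeff k * (Real.Gamma ((k : ℝ) + 1 / 2) *
        Real.Gamma ((k : ℝ) + 3 / 2) / (2 * Real.Gamma (2 + k) * k.factorial))) := by
  have h1 := Gamma_neg_half_ne_zero
  have h2 : (k.factorial : ℝ) ≠ 0 := by positivity
  have h3 : Real.Gamma (2 + (k : ℝ)) ≠ 0 := (Real.Gamma_pos_of_pos (by positivity)).ne'
  rw [hyp32Term, sqrtCoeff, add_comm 1 (k : ℝ), Real.Gamma_nat_eq_factorial, one_pow,
    add_comm (k : ℝ), add_comm (k : ℝ)]
  generalize Real.Gamma (-1 / 2) = g at *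
  generalize Real.Gamma (-1 / 2 + k) = g' at *
  field_simp

/-- Convergence at `z = 1` is inherited from the termwise integration, since the terms agree up to a
constant factor. -/
theorem summable_hyp32Term : Summable (hyp32Term (-1 / 2) (1 / 2) (3 / 2) 1 2 1) := by
  simp only [funext hyp32Term_eq_sqrtCoeff_mul]
  exact (hasSum_integral_sphere_sqrt_mul_sqrt (i := 0) (j := 1) (by decide)).summable.mul_left _

theorem hyp32_prefactor :
    Real.Gamma 1 * Real.Gamma 2 / (Real.Gamma (-1 / 2) * Real.Gamma (1 / 2) * Real.Gamma (3 / 2)) =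
      2 / (Real.pi * Real.Gamma (-1 / 2)) := by
  have h1 := Gamma_neg_half_ne_zero
  rw [show (3 / 2 : ℝ) = 1 / 2 + 1 by norm_num, Real.Gamma_add_one (by norm_num),
    Real.Gamma_one_half_eq, Real.Gamma_two, Real.Gamma_one]
  have hp : 0 < √Real.pi := Real.sqrt_pos.2 Real.pi_pos
  have := Real.pi_pos
  field_simp
  rw [Real.sq_sqrt this.le]

theorem integral_sphere_sqrt_mul_sqrt {i j : Fin 3} (hij : i ≠ j) :
    ∫ U : sphere (0 : EuclideanSpace ℝ (Fin 3)) 1,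
        √(1 - (U : EuclideanSpace ℝ (Fin 3)) i ^ 2) * √(1 - (U : EuclideanSpace ℝ (Fin 3)) j ^ 2)
        ∂(uniformSphere (EuclideanSpace ℝ (Fin 3))) =
      Real.pi / 4 * hyp32 (-1 / 2) (1 / 2) (3 / 2) 1 2 1 := by
  have h1 := Gamma_neg_half_ne_zero
  have := Real.pi_pos
  rw [hyp32, hyp32_prefactor, tsum_congr hyp32Term_eq_sqrtCoeff_mul, tsum_mul_left,
    (hasSum_integral_sphere_sqrt_mul_sqrt hij).tsum_eq]
  generalize Real.Gamma (-1 / 2) = g at *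
  field_simp
  norm_num

/-! ### The numerical bound -/

/-- The `k`-th term of the normalised hypergeometric series. -/
noncomputable def normalizedTerm (k : ℕ) : ℝ :=
  2 / (Real.pi * Real.Gamma (-1 / 2)) * hyp32Term (-1 / 2) (1 / 2) (3 / 2) 1 2 1 k

theorem normalizedTerm_zero : normalizedTerm 0 = 1 := by
  have h1 := Gamma_neg_half_ne_zero
  have hp : Real.Gamma (1 / 2) ≠ 0 := (Real.Gamma_pos_of_pos (by norm_num)).ne'
  have hq : Real.Gamma (3 / 2) ≠ 0 := (Real.Gamma_pos_of_pos (by norm_num)).ne'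
  rw [normalizedTerm, ← hyp32_prefactor, hyp32Term]
  simp
  norm_num at *
  field_simp

theorem normalizedTerm_succ (k : ℕ) :
    normalizedTerm (k + 1) = normalizedTerm k *
      ((-1 / 2 + k) * (1 / 2 + k) * (3 / 2 + k) / ((k + 1) ^ 2 * (k + 2))) := by
  have h3 : Real.Gamma (2 + (k : ℝ)) ≠ 0 := (Real.Gamma_pos_of_pos (by positivity)).ne'
  have h2 : (k.factorial : ℝ) ≠ 0 := by positivity
  have e : ∀ a : ℝ, 0 < a → Real.Gamma (a + (k + 1 : ℕ)) = (a + k) * Real.Gamma (a + k) := by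
    intro a ha
    rw [← Real.Gamma_add_one (by positivity)]
    push_cast; ring_nf
  rw [normalizedTerm, normalizedTerm, mul_assoc]
  congr 1
  rw [hyp32Term, hyp32Term, Gamma_neg_half_add_nat_succ, e _ (by norm_num), e _ (by norm_num),
    e _ (by norm_num), e _ (by norm_num), add_comm 1 (k : ℝ), Real.Gamma_nat_eq_factorial,
    Nat.factorial_succ]
  push_cast
  field_simp
  ring

theorem normalizedTerm_succ_nonpos (k : ℕ) : normalizedTerm (k + 1) ≤ 0 := by
  induction k with
  | zero => rw [normalizedTerm_succ, normalizedTerm_zero]; norm_num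
  | succ k ih =>
    rw [normalizedTerm_succ]
    refine mul_nonpos_of_nonpos_of_nonneg ih (div_nonneg (mul_nonneg (mul_nonneg ?_ ?_) ?_) ?_)
    · push_cast
      have : (0 : ℝ) ≤ k := by positivity
      linarith
    all_goals positivity

theorem hyp32_lt : hyp32 (-1 / 2) (1 / 2) (3 / 2) 1 2 1 < 765 / 1000 := by
  have hs : Summable normalizedTerm := summable_hyp32Term.mul_left _
  have h : hyp32 (-1 / 2) (1 / 2) (3 / 2) 1 2 1 = ∑' k, normalizedTerm k := by
    rw [hyp32, hyp32_prefactor, ← tsum_mul_left]; rfl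
  -- Six is the least number of terms whose sum lies below 0.765; with `π > 3.14` the final
  -- inequality tolerates values up to about 0.7653.
  rw [h, ← hs.sum_add_tsum_nat_add 6]
  have ht : ∑' k, normalizedTerm (k + 6) ≤ 0 := tsum_nonpos fun k => normalizedTerm_succ_nonpos _
  have : ∑ k ∈ Finset.range 6, normalizedTerm k < 765 / 1000 := by
    simp only [Finset.sum_range_succ, Finset.sum_range_zero, normalizedTerm_succ,
      normalizedTerm_zero]
    norm_num
  linarith

theorem second_moment_lt :
    2 / Real.pi ^ 2 * (4 + 3 * Real.pi * hyp32 (-1 / 2) (1 / 2) (3 / 2) 1 2 1)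
      < 1 + 4 / Real.pi := by
  have h := hyp32_lt
  have hp := Real.pi_gt_d2
  have hp0 := Real.pi_pos
  have h1 : 3 * Real.pi * hyp32 (-1 / 2) (1 / 2) (3 / 2) 1 2 1 < 3 * Real.pi * (765 / 1000) := by
    gcongr
  rw [div_mul_eq_mul_div, div_lt_iff₀ (by positivity)]
  have : (1 + 4 / Real.pi) * Real.pi ^ 2 = Real.pi ^ 2 + 4 * Real.pi := by field_simp
  rw [this]
  nlinarith

/-! ### Widths of the projected cube -/

section Cube

variable {n : ℕ}

/-- The orthogonal projection onto the hyperplane orthogonal to `U`. -/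
noncomputable abbrev hyperplaneProj (U : sphere (0 : EuclideanSpace ℝ (Fin n)) 1) :
    EuclideanSpace ℝ (Fin n) →L[ℝ] ((ℝ ∙ (U : EuclideanSpace ℝ (Fin n)))ᗮ : Submodule ℝ _) :=
  ((ℝ ∙ (U : EuclideanSpace ℝ (Fin n)))ᗮ).orthogonalProjectionOnto

theorem inner_hyperplaneProj (U : sphere (0 : EuclideanSpace ℝ (Fin n)) 1)
    (u : ((ℝ ∙ (U : EuclideanSpace ℝ (Fin n)))ᗮ : Submodule ℝ (EuclideanSpace ℝ (Fin n))))
    (x : EuclideanSpace ℝ (Fin n)) :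
    ⟪u, hyperplaneProj U x⟫ = ∑ i, (u : EuclideanSpace ℝ (Fin n)) i * x i := by
  rw [Submodule.inner_orthogonalProjectionOnto_eq_of_mem_left, PiLp.inner_apply]
  simp [mul_comm]

theorem coe_hyperplaneProj (U : sphere (0 : EuclideanSpace ℝ (Fin n)) 1)
    (x : EuclideanSpace ℝ (Fin n)) :
    (hyperplaneProj U x : EuclideanSpace ℝ (Fin n)) =
      x - ⟪(U : EuclideanSpace ℝ (Fin n)), x⟫ • (U : EuclideanSpace ℝ (Fin n)) := by
  have h := Submodule.starProjection_orthogonal_val (K := ℝ ∙ (U : EuclideanSpace ℝ (Fin n))) x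
  rw [Submodule.starProjection_unit_singleton ℝ (norm_eq_of_mem_sphere U)] at h
  exact h

theorem norm_hyperplaneProj_single (U : sphere (0 : EuclideanSpace ℝ (Fin n)) 1) (i : Fin n) :
    ‖hyperplaneProj U (EuclideanSpace.single i 1)‖ =
      √(1 - (U : EuclideanSpace ℝ (Fin n)) i ^ 2) := by
  rw [← Real.sqrt_sq (norm_nonneg _), Submodule.coe_norm, coe_hyperplaneProj,
    norm_sub_sq_real, norm_smul, norm_eq_of_mem_sphere, inner_smul_right,
    real_inner_comm, EuclideanSpace.inner_single_left]
  congr 1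
  simp
  ring

theorem image_inner_projectedCube (U : sphere (0 : EuclideanSpace ℝ (Fin n)) 1)
    (u : ((ℝ ∙ (U : EuclideanSpace ℝ (Fin n)))ᗮ : Submodule ℝ (EuclideanSpace ℝ (Fin n)))) :
    IsGreatest ((fun x => ⟪u, x⟫) '' projectedCube U)
      (1 / 2 * ∑ i, |(u : EuclideanSpace ℝ (Fin n)) i|) ∧
    IsLeast ((fun x => ⟪u, x⟫) '' projectedCube U)
      (-(1 / 2 * ∑ i, |(u : EuclideanSpace ℝ (Fin n)) i|)) := by
  have hle : ∀ x ∈ unitCube n, |∑ i, (u : EuclideanSpace ℝ (Fin n)) i * x i| ≤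
      1 / 2 * ∑ i, |(u : EuclideanSpace ℝ (Fin n)) i| := by
    intro x hx
    rw [Finset.mul_sum]
    refine (Finset.abs_sum_le_sum_abs _ _).trans (Finset.sum_le_sum fun i _ => ?_)
    rw [abs_mul, mul_comm (1 / 2 : ℝ)]
    exact mul_le_mul_of_nonneg_left (hx i) (abs_nonneg _)
  -- The point with coordinates `sign(uᵢ)/2` maximises and its antipode minimises; `s = 1` and `s =
  -- -1` give the two.
  have hmem : ∀ s : ℝ, |s| ≤ 1 →
      s * (1 / 2 * ∑ i, |(u : EuclideanSpace ℝ (Fin n)) i|) ∈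
        (fun x => ⟪u, x⟫) '' projectedCube U := by
    intro s hs
    refine ⟨_, ⟨WithLp.toLp 2 fun i =>
      s * (SignType.sign ((u : EuclideanSpace ℝ (Fin n)) i) / 2), fun i => ?_, rfl⟩, ?_⟩
    · have h1 : |((SignType.sign ((u : EuclideanSpace ℝ (Fin n)) i) : SignType) : ℝ)| ≤ 1 := by
        rcases lt_trichotomy ((u : EuclideanSpace ℝ (Fin n)) i) 0 with h | h | h <;> simp [h]
      simp only [abs_mul, abs_div, abs_two]
      have := mul_le_mul hs h1 (abs_nonneg _) zero_le_one
      linarith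
    · simp only [inner_hyperplaneProj, Finset.mul_sum]
      refine Finset.sum_congr rfl fun i _ => ?_
      rw [← self_mul_sign]
      ring
  refine ⟨⟨by simpa using hmem 1 (by simp), ?_⟩, ⟨by simpa using hmem (-1) (by simp), ?_⟩⟩
  · rintro _ ⟨_, ⟨x, hx, rfl⟩, rfl⟩
    simp only [inner_hyperplaneProj]
    exact (abs_le.1 (hle x hx)).2
  · rintro _ ⟨_, ⟨x, hx, rfl⟩, rfl⟩
    simp only [inner_hyperplaneProj]
    exact (abs_le.1 (hle x hx)).1

theorem directionalWidth_projectedCube (U : sphere (0 : EuclideanSpace ℝ (Fin n)) 1)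
    (u : ((ℝ ∙ (U : EuclideanSpace ℝ (Fin n)))ᗮ : Submodule ℝ (EuclideanSpace ℝ (Fin n)))) :
    directionalWidth (projectedCube U) u = ∑ i, |(u : EuclideanSpace ℝ (Fin n)) i| := by
  obtain ⟨h1, h2⟩ := image_inner_projectedCube U u
  rw [directionalWidth, h1.csSup_eq, h2.csInf_eq]
  ring

end Cube

/-! ### Mean width in dimension three: formula, extremes, moments -/

theorem finrank_hyperplane_three (U : sphere (0 : EuclideanSpace ℝ (Fin 3)) 1) :
    Module.finrank ℝ ((ℝ ∙ (U : EuclideanSpace ℝ (Fin 3)))ᗮ : Submodule ℝ _) = 2 :=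
  haveI : Fact (Module.finrank ℝ (EuclideanSpace ℝ (Fin 3)) = 2 + 1) := ⟨by simp⟩
  Submodule.finrank_orthogonal_span_singleton (ne_zero_of_mem_unit_sphere U)

theorem projectedMeanWidth_eq (U : sphere (0 : EuclideanSpace ℝ (Fin 3)) 1) :
    projectedMeanWidth U =
      2 / Real.pi * ∑ i : Fin 3, √(1 - (U : EuclideanSpace ℝ (Fin 3)) i ^ 2) := by
  have hV := finrank_hyperplane_three U
  have : Nontrivial ((ℝ ∙ (U : EuclideanSpace ℝ (Fin 3)))ᗮ : Submodule ℝ _) :=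
    Module.nontrivial_of_finrank_pos (R := ℝ) (by omega)
  have hc : ∀ (i : Fin 3)
      (u : ((ℝ ∙ (U : EuclideanSpace ℝ (Fin 3)))ᗮ : Submodule ℝ (EuclideanSpace ℝ (Fin 3)))),
      (u : EuclideanSpace ℝ (Fin 3)) i = ⟪u, hyperplaneProj U (EuclideanSpace.single i 1)⟫ := by
    intro i u
    rw [inner_hyperplaneProj]; simp
  rw [projectedMeanWidth, meanWidth]
  simp only [directionalWidth_projectedCube, hc]
  rw [integral_finsetSum, Finset.mul_sum]
  · refine Finset.sum_congr rfl fun i _ => ?_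
    rw [integral_abs_inner_uniformSphere hV, norm_hyperplaneProj_single]
  · intro i _
    exact Continuous.integrable_of_hasCompactSupport (by fun_prop) (HasCompactSupport.of_compactSpace _)

theorem sum_one_sub_sq_eq_two (U : sphere (0 : EuclideanSpace ℝ (Fin 3)) 1) :
    ∑ i : Fin 3, (1 - (U : EuclideanSpace ℝ (Fin 3)) i ^ 2) = 2 := by
  rw [Finset.sum_sub_distrib, sum_sq_coord_eq_one]; norm_num

theorem isGreatest_projectedMeanWidth :
    IsGreatest (Set.range fun U : sphere (0 : EuclideanSpace ℝ (Fin 3)) 1 => projectedMeanWidth U)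
      (2 * √6 / Real.pi) := by
  have hp := Real.pi_pos
  constructor
  · have h : WithLp.toLp 2 (fun _ : Fin 3 => √(1 / 3)) ∈ sphere (0 : EuclideanSpace ℝ (Fin 3)) 1 := by
      rw [mem_sphere_zero_iff_norm, EuclideanSpace.norm_eq]
      simp
    refine ⟨⟨_, h⟩, ?_⟩
    simp only [projectedMeanWidth_eq, Real.sq_sqrt (show (0 : ℝ) ≤ 1 / 3 by norm_num)]
    have : √6 = 3 * √(1 - 1 / 3) := by
      rw [show (6 : ℝ) = 3 ^ 2 * (1 - 1 / 3) by norm_num, Real.sqrt_mul (by norm_num),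
        Real.sqrt_sq (by norm_num)]
    rw [this]
    simp
    ring
  · rintro _ ⟨U, rfl⟩
    simp only [projectedMeanWidth_eq]
    have h : (∑ i : Fin 3, √(1 - (U : EuclideanSpace ℝ (Fin 3)) i ^ 2)) ^ 2 ≤ 6 := by
      refine sq_sum_le_card_mul_sum_sq.trans ?_
      have : ∀ i, √(1 - (U : EuclideanSpace ℝ (Fin 3)) i ^ 2) ^ 2 =
        1 - (U : EuclideanSpace ℝ (Fin 3)) i ^ 2 :=
        fun i => Real.sq_sqrt (by linarith [sq_coord_le_one U i])
      simp only [this, sum_one_sub_sq_eq_two]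
      norm_num
    have h' := Real.le_sqrt_of_sq_le h
    rw [div_mul_eq_mul_div]
    gcongr

theorem isLeast_projectedMeanWidth :
    IsLeast (Set.range fun U : sphere (0 : EuclideanSpace ℝ (Fin 3)) 1 => projectedMeanWidth U)
      (4 / Real.pi) := by
  have hp := Real.pi_pos
  constructor
  · refine ⟨⟨EuclideanSpace.single 0 1, by simp⟩, ?_⟩
    simp only [projectedMeanWidth_eq, Fin.sum_univ_three]
    simp
    ring
  · rintro _ ⟨U, rfl⟩
    simp only [projectedMeanWidth_eq]
    have h : 2 ≤ ∑ i : Fin 3, √(1 - (U : EuclideanSpace ℝ (Fin 3)) i ^ 2) := by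
      rw [← sum_one_sub_sq_eq_two U]
      refine Finset.sum_le_sum fun i _ => Real.le_sqrt_of_sq_le ?_
      have := sq_coord_le_one U i
      nlinarith [sq_nonneg ((U : EuclideanSpace ℝ (Fin 3)) i)]
    calc 4 / Real.pi = 2 / Real.pi * 2 := by ring
      _ ≤ _ := by gcongr

theorem integrable_projectedMeanWidth_pow (k : ℕ) :
    Integrable (fun U => projectedMeanWidth U ^ k)
      (uniformSphere (EuclideanSpace ℝ (Fin 3))) := by
  simp only [projectedMeanWidth_eq]
  exact Continuous.integrable_of_hasCompactSupport (by fun_prop) (HasCompactSupport.of_compactSpace _)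

theorem integral_projectedMeanWidth :
    ∫ U, projectedMeanWidth U ∂(uniformSphere (EuclideanSpace ℝ (Fin 3))) = 3 / 2 := by
  have hp := Real.pi_pos
  simp only [projectedMeanWidth_eq]
  rw [integral_const_mul, integral_finsetSum]
  · simp only [integral_sphere_sqrt, Finset.sum_const, Finset.card_univ, Fintype.card_fin]
    simp
    field_simp
    norm_num
  · exact fun i _ => Continuous.integrable_of_hasCompactSupport (by fun_prop)
      (HasCompactSupport.of_compactSpace _)

theorem integral_projectedMeanWidth_sq :
    ∫ U, projectedMeanWidth U ^ 2 ∂(uniformSphere (EuclideanSpace ℝ (Fin 3))) =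
      2 / Real.pi ^ 2 * (4 + 3 * Real.pi * hyp32 (-1 / 2) (1 / 2) (3 / 2) 1 2 1) := by
  have hp := Real.pi_pos
  have e : ∀ U : sphere (0 : EuclideanSpace ℝ (Fin 3)) 1, projectedMeanWidth U ^ 2 =
      4 / Real.pi ^ 2 * (2 + ∑ p ∈ (Finset.univ : Finset (Fin 3)).offDiag,
        √(1 - (U : EuclideanSpace ℝ (Fin 3)) p.1 ^ 2) *
          √(1 - (U : EuclideanSpace ℝ (Fin 3)) p.2 ^ 2)) := by
    intro U
    rw [projectedMeanWidth_eq, mul_pow, sq (∑ i : Fin 3, _), Finset.sum_mul_sum,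
      ← Finset.sum_product', ← Finset.diag_union_offDiag, Finset.sum_union (Finset.disjoint_diag_offDiag _),
      Finset.sum_diag]
    have : ∀ i, √(1 - (U : EuclideanSpace ℝ (Fin 3)) i ^ 2) *
        √(1 - (U : EuclideanSpace ℝ (Fin 3)) i ^ 2) = 1 - (U : EuclideanSpace ℝ (Fin 3)) i ^ 2 :=
      fun i => Real.mul_self_sqrt (by linarith [sq_coord_le_one U i])
    simp only [this, sum_one_sub_sq_eq_two]
    ring
  have hint : ∀ p : Fin 3 × Fin 3, Integrable (fun U : sphere (0 : EuclideanSpace ℝ (Fin 3)) 1 =>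
      √(1 - (U : EuclideanSpace ℝ (Fin 3)) p.1 ^ 2) * √(1 - (U : EuclideanSpace ℝ (Fin 3)) p.2 ^ 2))
      (uniformSphere (EuclideanSpace ℝ (Fin 3))) :=
    fun p => Continuous.integrable_of_hasCompactSupport (by fun_prop)
      (HasCompactSupport.of_compactSpace _)
  simp only [e]
  rw [integral_const_mul, integral_add (integrable_const _) (integrable_finsetSum _ fun p _ => hint p),
    integral_finsetSum _ fun p _ => hint p,
    Finset.sum_congr rfl fun p hp => integral_sphere_sqrt_mul_sqrt (Finset.mem_offDiag.1 hp).2.2]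
  simp [Finset.offDiag_card]
  field_simp
  ring

/-! ### The boundary of the shadow -/

/-- The normalising constant does not depend on `X`; on `ℝ` both measures are Lebesgue measure, and
`[0, 1]` shows that it is 1. -/
theorem euclideanHausdorffMeasure_one (X : Type*) [EMetricSpace X] [MeasurableSpace X]
    [BorelSpace X] : (Measure.euclideanHausdorffMeasure 1 : Measure X) = Measure.hausdorffMeasure 1 := by
  have h := InnerProductSpace.euclideanHausdorffMeasure_eq_volume (V := ℝ)
  rw [Module.finrank_self, Measure.euclideanHausdorffMeasure_def] at h
  rw [Measure.euclideanHausdorffMeasure_def]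
  generalize Measure.addHaarScalarFactor (volume : Measure (EuclideanSpace ℝ (Fin 1)))
    (Measure.hausdorffMeasure ((1 : ℕ) : ℝ)) = c at h ⊢
  rw [Nat.cast_one, hausdorffMeasure_real] at h
  have h1 := congrArg (fun μ : Measure ℝ => μ (Set.Icc 0 1)) h
  simp only [Measure.smul_apply, Real.volume_Icc, sub_zero, ENNReal.ofReal_one] at h1
  rw [ENNReal.smul_def, smul_eq_mul, mul_one, ENNReal.coe_eq_one] at h1
  rw [Nat.cast_one, h1, one_smul]

section Frontier

variable {n : ℕ} (U : sphere (0 : EuclideanSpace ℝ (Fin n)) 1)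

/-- The sign of the `i`-th coordinate of `U`. -/
noncomputable def coordSign (i : Fin n) : ℝ :=
  (SignType.sign ((U : EuclideanSpace ℝ (Fin n)) i) : SignType)

theorem coordSign_mul_coord (i : Fin n) :
    coordSign U i * (U : EuclideanSpace ℝ (Fin n)) i = |(U : EuclideanSpace ℝ (Fin n)) i| :=
  sign_mul_self _

theorem hyperplaneProj_self : hyperplaneProj U (U : EuclideanSpace ℝ (Fin n)) = 0 :=
  Submodule.orthogonalProjectionOnto_orthogonalComplement_singleton_eq_zero _

theorem exists_smul_of_hyperplaneProj_eq {x y : EuclideanSpace ℝ (Fin n)}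
    (h : hyperplaneProj U x = hyperplaneProj U y) :
    ∃ s : ℝ, y = x + s • (U : EuclideanSpace ℝ (Fin n)) := by
  have h' := congrArg (Subtype.val) h
  rw [coe_hyperplaneProj, coe_hyperplaneProj] at h'
  refine ⟨⟪(U : EuclideanSpace ℝ (Fin n)), y⟫ - ⟪(U : EuclideanSpace ℝ (Fin n)), x⟫, ?_⟩
  rw [sub_smul, ← add_sub_assoc, add_sub_right_comm, h', sub_add_cancel]

theorem isOpenMap_hyperplaneProj : IsOpenMap (hyperplaneProj U) :=
  (hyperplaneProj U).isOpenMap fun u =>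
    ⟨u, Submodule.orthogonalProjectionOnto_mem_subspace_eq_self u⟩

theorem isCompact_unitCube : IsCompact (unitCube n) := by
  refine Metric.isCompact_of_isClosed_isBounded ?_ ?_
  · simp only [unitCube, Set.ofPred_forall]
    exact isClosed_iInter fun i => isClosed_le (by fun_prop) continuous_const
  · refine (Metric.isBounded_iff_subset_closedBall 0).2 ⟨√(n * (1 / 2) ^ 2), fun x hx => ?_⟩
    rw [mem_closedBall_zero_iff, EuclideanSpace.norm_eq]
    refine Real.sqrt_le_sqrt ?_
    refine (Finset.sum_le_sum fun i _ => pow_le_pow_left₀ (norm_nonneg _) (hx i) 2).trans ?_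
    simp

theorem isClosed_projectedCube : IsClosed (projectedCube U) :=
  (isCompact_unitCube.image (hyperplaneProj U).continuous).isClosed

variable {U} (hU : ∀ i, (U : EuclideanSpace ℝ (Fin n)) i ≠ 0)

include hU in
theorem coordSign_mul_self (i : Fin n) : coordSign U i * coordSign U i = 1 := by
  rcases (hU i).lt_or_gt with h | h <;> simp [coordSign, h]

include hU in
theorem abs_coordSign_mul (i : Fin n) (t : ℝ) : |coordSign U i * t| = |t| := by
  rcases (hU i).lt_or_gt with h | h <;> simp [coordSign, h]

include hU in
-- If no coordinate blocks the motion of `x` along `σU`, a small step leads into the open cube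
-- without changing the projection, and the projection is an open map.
theorem hyperplaneProj_mem_interior {x : EuclideanSpace ℝ (Fin n)} (hx : x ∈ unitCube n) {σ : ℝ}
    (hσ : |σ| = 1) (h : ∀ i, σ * (coordSign U i * x i) < 1 / 2) :
    hyperplaneProj U x ∈ interior (projectedCube U) := by
  have hσσ : σ * σ = 1 := by rw [← abs_mul_abs_self, hσ, one_mul]
  have key : ∀ᶠ s in nhdsWithin (0 : ℝ) (Set.Ioi 0), ∀ i,
      |x i + s * σ * (U : EuclideanSpace ℝ (Fin n)) i| < 1 / 2 := by
    rw [Filter.eventually_all]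
    intro i
    have hc : Filter.Tendsto (fun s : ℝ => σ * (coordSign U i * x i) +
        s * |(U : EuclideanSpace ℝ (Fin n)) i|) (nhdsWithin 0 (Set.Ioi 0))
        (nhds (σ * (coordSign U i * x i) + 0 * |(U : EuclideanSpace ℝ (Fin n)) i|)) :=
      (Continuous.tendsto (by fun_prop) 0).mono_left nhdsWithin_le_nhds
    have h1 := hc.eventually_lt_const (u := 1 / 2) (by simpa using h i)
    filter_upwards [h1, self_mem_nhdsWithin] with s hs1 hs2
    have hs2 : 0 < s := hs2
    have hpos := abs_pos.2 (hU i)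
    have e : σ * (coordSign U i * (x i + s * σ * (U : EuclideanSpace ℝ (Fin n)) i)) =
        σ * (coordSign U i * x i) + s * |(U : EuclideanSpace ℝ (Fin n)) i| := by
      rw [← coordSign_mul_coord]
      linear_combination (s * coordSign U i * (U : EuclideanSpace ℝ (Fin n)) i) * hσσ
    have e' := congrArg abs e
    rw [abs_mul, hσ, one_mul, abs_coordSign_mul hU] at e'
    rw [e', abs_lt]
    have h3 : |σ * (coordSign U i * x i)| ≤ 1 / 2 := by
      rw [abs_mul, hσ, one_mul, abs_coordSign_mul hU]; exact hx i
    have := (abs_le.1 h3).1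
    have := mul_pos hs2 hpos
    constructor <;> linarith
  obtain ⟨s, hs⟩ := key.exists
  have hopen : IsOpen {y : EuclideanSpace ℝ (Fin n) | ∀ i, |y i| < 1 / 2} := by
    simp only [Set.ofPred_forall]
    exact isOpen_iInter_of_finite fun i => isOpen_lt (by fun_prop) continuous_const
  refine interior_maximal (Set.image_mono fun y hy i => (hy i).le)
    (isOpenMap_hyperplaneProj U _ hopen) ?_
  refine ⟨x + (s * σ) • (U : EuclideanSpace ℝ (Fin n)), fun i => by simpa using hs i, ?_⟩
  rw [map_add, map_smul, hyperplaneProj_self, smul_zero, add_zero]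

variable (U) in
/-- The face of the cube on which the `i`-th coordinate has the sign of `Uᵢ` and the `j`-th
coordinate has the sign opposite to that of `Uⱼ`. -/
def silhouetteFace (p : Fin n × Fin n) : Set (EuclideanSpace ℝ (Fin n)) :=
  {x ∈ unitCube n | x p.1 = coordSign U p.1 / 2 ∧ x p.2 = -(coordSign U p.2 / 2)}

include hU in
-- The direction `w` pushes both fixed coordinates outwards. Returning to the cube along `U` needs
-- `s ≤ 0` for the first and `s ≥ 0` for the second. The case `t = 0` makes the projection injective
-- over the face; `t > 0` puts the image on the boundary.
theorem not_mem_cube_of_mem_silhouetteFace {p : Fin n × Fin n} {x : EuclideanSpace ℝ (Fin n)}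
    (hx : x ∈ silhouetteFace U p) {s t : ℝ} (ht : 0 ≤ t) {w : EuclideanSpace ℝ (Fin n)}
    (hw1 : w p.1 = coordSign U p.1) (hw2 : w p.2 = -coordSign U p.2)
    (hy : x + t • w + s • (U : EuclideanSpace ℝ (Fin n)) ∈ unitCube n) : t = 0 ∧ s = 0 := by
  have h1 := hy p.1
  have h2 := hy p.2
  rw [← abs_coordSign_mul hU] at h1 h2
  simp only [PiLp.add_apply, PiLp.smul_apply, smul_eq_mul, hx.2.1, hx.2.2, hw1, hw2] at h1 h2
  have e1 : coordSign U p.1 * (coordSign U p.1 / 2 + t * coordSign U p.1 +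
      s * (U : EuclideanSpace ℝ (Fin n)) p.1) =
      1 / 2 + t + s * |(U : EuclideanSpace ℝ (Fin n)) p.1| := by
    rw [← coordSign_mul_coord]
    linear_combination (1 / 2 + t) * coordSign_mul_self hU p.1
  have e2 : coordSign U p.2 * (-(coordSign U p.2 / 2) + t * -coordSign U p.2 +
      s * (U : EuclideanSpace ℝ (Fin n)) p.2) =
      -(1 / 2 + t - s * |(U : EuclideanSpace ℝ (Fin n)) p.2|) := by
    rw [← coordSign_mul_coord]
    linear_combination (-(1 / 2 + t)) * coordSign_mul_self hU p.2
  rw [e1] at h1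
  rw [e2, abs_neg] at h2
  have h1 := (abs_le.1 h1).2
  have h2 := (abs_le.1 h2).2
  have hp1 := abs_pos.2 (hU p.1)
  have hp2 := abs_pos.2 (hU p.2)
  have hs1 : s ≤ 0 := by
    by_contra! h
    have := mul_pos h hp1
    linarith
  have hs2 : 0 ≤ s := by
    by_contra! h
    have := mul_neg_of_neg_of_pos h hp2
    linarith
  have hs : s = 0 := le_antisymm hs1 hs2
  subst hs
  exact ⟨by linarith, rfl⟩

/-- A vector with the prescribed coordinates at two indices. -/
theorem exists_apply_eq_apply_eq {i j : Fin n} (hij : i ≠ j) (a b : ℝ) :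
    ∃ w : EuclideanSpace ℝ (Fin n), w i = a ∧ w j = b :=
  ⟨WithLp.toLp 2 fun k => if k = i then a else b, by simp, by simp [hij.symm]⟩

include hU in
theorem eq_of_mem_silhouetteFace {p : Fin n × Fin n} (hp : p.1 ≠ p.2)
    {x y : EuclideanSpace ℝ (Fin n)} (hx : x ∈ silhouetteFace U p) (hy : y ∈ unitCube n)
    (h : hyperplaneProj U x = hyperplaneProj U y) : x = y := by
  obtain ⟨w, hw1, hw2⟩ := exists_apply_eq_apply_eq hp (coordSign U p.1) (-coordSign U p.2)
  obtain ⟨s, rfl⟩ := exists_smul_of_hyperplaneProj_eq U h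
  have := (not_mem_cube_of_mem_silhouetteFace hU hx (t := 0) le_rfl hw1 hw2 (s := s)
    (by simpa using hy)).2
  simp [this]

include hU in
theorem hyperplaneProj_not_mem_interior {p : Fin n × Fin n} (hp : p.1 ≠ p.2)
    {x : EuclideanSpace ℝ (Fin n)} (hx : x ∈ silhouetteFace U p) :
    hyperplaneProj U x ∉ interior (projectedCube U) := by
  intro hi
  obtain ⟨w, hw1, hw2⟩ := exists_apply_eq_apply_eq hp (coordSign U p.1) (-coordSign U p.2)
  have hc : Filter.Tendsto (fun t : ℝ => hyperplaneProj U (x + t • w))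
      (nhdsWithin 0 (Set.Ioi 0)) (nhds (hyperplaneProj U (x + (0 : ℝ) • w))) :=
    (Continuous.tendsto (by fun_prop) 0).mono_left nhdsWithin_le_nhds
  rw [zero_smul, add_zero] at hc
  have hev := hc.eventually_mem (mem_interior_iff_mem_nhds.1 hi)
  obtain ⟨t, ⟨y, hy, hyt⟩, ht⟩ := (hev.and self_mem_nhdsWithin).exists
  have ht : 0 < t := ht
  obtain ⟨s, rfl⟩ := exists_smul_of_hyperplaneProj_eq U (x := x + t • w) hyt.symm
  exact ht.ne' (not_mem_cube_of_mem_silhouetteFace hU hx ht.le hw1 hw2 hy).1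

include hU in
-- A cube point projects to the boundary exactly when it is blocked in both directions `U` and `-U`,
-- by one coordinate each.
theorem frontier_projectedCube :
    frontier (projectedCube U) =
      ⋃ p ∈ (Finset.univ : Finset (Fin n)).offDiag, hyperplaneProj U '' silhouetteFace U p := by
  rw [(isClosed_projectedCube U).frontier_eq]
  ext z
  simp only [Set.mem_sdiff, Set.mem_iUnion, Finset.mem_offDiag, Finset.mem_univ, true_and,
    exists_prop]
  constructor
  · rintro ⟨⟨x, hx, rfl⟩, hz⟩
    have hex : ∀ σ : ℝ, |σ| = 1 → ∃ i, x i = σ * (coordSign U i / 2) := by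
      intro σ hσ
      by_contra! hne
      refine hz (hyperplaneProj_mem_interior hU hx hσ fun i => ?_)
      have hσσ : σ * σ = 1 := by rw [← abs_mul_abs_self, hσ, one_mul]
      have hle : σ * (coordSign U i * x i) ≤ 1 / 2 := by
        refine (le_abs_self _).trans ?_
        rw [abs_mul, hσ, one_mul, abs_coordSign_mul hU]; exact hx i
      refine lt_of_le_of_ne hle fun he => hne i ?_
      linear_combination (σ * coordSign U i) * he - x i * σ * σ * coordSign_mul_self hU i -
        x i * hσσ
    obtain ⟨i, hi⟩ := hex 1 (by simp)
    obtain ⟨j, hj⟩ := hex (-1) (by simp)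
    refine ⟨(i, j), ?_, x, ⟨hx, by linarith, by linarith⟩, rfl⟩
    rintro h
    simp only at h
    subst h
    have h0 : coordSign U i = 0 := by linarith
    have := coordSign_mul_self hU i
    rw [h0] at this
    norm_num at this
  · rintro ⟨p, hp, x, hx, rfl⟩
    exact ⟨⟨x, hx.1, rfl⟩, hyperplaneProj_not_mem_interior hU hp hx⟩

end Frontier

/-! ### The perimeter in dimension three -/

section Perimeter

variable {U : sphere (0 : EuclideanSpace ℝ (Fin 3)) 1}
  (hU : ∀ i, (U : EuclideanSpace ℝ (Fin 3)) i ≠ 0)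

/-- As `0 + 1 + 2 = 0` in `Fin 3`, the third index is `-i - j`. -/
theorem fin_three_eq_or_eq_or_eq {i j : Fin 3} (hij : i ≠ j) (m : Fin 3) :
    m = i ∨ m = j ∨ m = -i - j := by
  revert i j m; decide

theorem fin_three_third_ne {i j : Fin 3} (hij : i ≠ j) : -i - j ≠ i ∧ -i - j ≠ j := by
  revert i j; decide

include hU in
theorem silhouetteFace_eq_segment {p : Fin 3 × Fin 3} (hp : p.1 ≠ p.2) :
    ∃ a, silhouetteFace U p =
      segment ℝ a (a + EuclideanSpace.single (-p.1 - p.2) (1 : ℝ)) := by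
  obtain ⟨i, j⟩ := p
  simp only at hp ⊢
  obtain ⟨hk1, hk2⟩ := fin_three_third_ne hp
  set k := -i - j
  refine ⟨WithLp.toLp 2 fun m => if m = i then coordSign U i / 2 else
    if m = j then -(coordSign U j / 2) else -(1 / 2), ?_⟩
  have hs : ∀ m, |coordSign U m / 2| ≤ 1 / 2 := by
    intro m
    rw [← abs_coordSign_mul hU m, mul_div_assoc', coordSign_mul_self hU]
    norm_num
  rw [segment_eq_image']
  ext x
  simp only [Set.mem_image, add_sub_cancel_left]
  constructor
  · rintro ⟨hx, h1, h2⟩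
    have h1 : x i = coordSign U i / 2 := h1
    have h2 : x j = -(coordSign U j / 2) := h2
    have h3 := abs_le.1 (hx k)
    refine ⟨x k + 1 / 2, ⟨by linarith, by linarith⟩, ?_⟩
    ext m
    rcases fin_three_eq_or_eq_or_eq hp m with rfl | rfl | h
    · simp [h1, hk1.symm]
    · simp [h2, hk2.symm, hp.symm]
    · have h : m = k := h
      subst h
      simp [hk1, hk2]
  · rintro ⟨θ, ⟨h0, h1⟩, rfl⟩
    refine ⟨fun m => ?_, ?_, ?_⟩
    · rcases fin_three_eq_or_eq_or_eq hp m with rfl | rfl | h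
      · simpa [hk1.symm] using hs m
      · simpa [hk2.symm, hp.symm] using hs m
      · have h : m = k := h
        subst h
        simp only [PiLp.add_apply, PiLp.smul_apply, hk1, hk2, if_false, PiLp.single_apply,
          if_true, smul_eq_mul, mul_one]
        rw [abs_le]
        constructor <;> linarith
    · simp [hk1.symm]
    · simp [hk2.symm, hp.symm]

include hU in
theorem hausdorffMeasure_image_silhouetteFace {p : Fin 3 × Fin 3} (hp : p.1 ≠ p.2) :
    Measure.hausdorffMeasure 1 (hyperplaneProj U '' silhouetteFace U p) =
      ENNReal.ofReal √(1 - (U : EuclideanSpace ℝ (Fin 3)) (-p.1 - p.2) ^ 2) := by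
  obtain ⟨a, ha⟩ := silhouetteFace_eq_segment hU hp
  have himg := image_segment ℝ (hyperplaneProj U).toLinearMap.toAffineMap a
    (a + EuclideanSpace.single (-p.1 - p.2) (1 : ℝ))
  simp only [LinearMap.coe_toAffineMap, ContinuousLinearMap.coe_coe] at himg
  rw [ha, himg, hausdorffMeasure_segment, edist_dist, dist_eq_norm, map_add, sub_add_cancel_left,
    norm_neg, norm_hyperplaneProj_single]

include hU in
-- Two distinct pairs either fix all three coordinates or are swaps of each other and demand
-- opposite signs. Hence the edge lengths add up.
theorem subsingleton_inter_silhouetteFace {p q : Fin 3 × Fin 3} (hp : p.1 ≠ p.2)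
    (hq : q.1 ≠ q.2) (hpq : p ≠ q) :
    (silhouetteFace U p ∩ silhouetteFace U q).Subsingleton := by
  rintro x ⟨hx, hx'⟩ y ⟨hy, hy'⟩
  ext m
  by_cases h1 : m = p.1
  · rw [h1, hx.2.1, hy.2.1]
  by_cases h2 : m = p.2
  · rw [h2, hx.2.2, hy.2.2]
  by_cases h3 : m = q.1
  · rw [h3, hx'.2.1, hy'.2.1]
  by_cases h4 : m = q.2
  · rw [h4, hx'.2.2, hy'.2.2]
  exfalso
  have key : ∀ i j i' j' m : Fin 3, i ≠ j → i' ≠ j' → m ≠ i → m ≠ j → m ≠ i' → m ≠ j' →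
      (i = i' ∧ j = j') ∨ i = j' := by omega
  rcases key _ _ _ _ _ hp hq h1 h2 h3 h4 with ⟨e1, e2⟩ | e
  · exact hpq (Prod.ext e1 e2)
  · have h5 := hx.2.1
    rw [e, hx'.2.2] at h5
    have h0 : coordSign U q.2 = 0 := by linarith
    have := coordSign_mul_self hU q.2
    rw [h0] at this
    norm_num at this

include hU in
theorem projectedSurfaceArea_eq :
    projectedSurfaceArea U = 2 * ∑ i : Fin 3, √(1 - (U : EuclideanSpace ℝ (Fin 3)) i ^ 2) := by
  have hmeas : Measure.hausdorffMeasure 1 (frontier (projectedCube U)) =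
      ∑ p ∈ (Finset.univ : Finset (Fin 3)).offDiag,
        ENNReal.ofReal √(1 - (U : EuclideanSpace ℝ (Fin 3)) (-p.1 - p.2) ^ 2) := by
    rw [frontier_projectedCube hU, measure_biUnion_finset₀]
    · refine Finset.sum_congr rfl fun p hp => ?_
      exact hausdorffMeasure_image_silhouetteFace hU (Finset.mem_offDiag.1 hp).2.2
    · intro p hp q hq hpq
      have hp := (Finset.mem_offDiag.1 hp).2.2
      have hq := (Finset.mem_offDiag.1 hq).2.2
      have hna := Measure.nullSingletonClass_hausdorff
        ((ℝ ∙ (U : EuclideanSpace ℝ (Fin 3)))ᗮ : Submodule ℝ _) one_pos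
      refine measure_mono_null ?_ (((subsingleton_inter_silhouetteFace hU hp hq hpq).image
        (hyperplaneProj U)).measure_zero _)
      rintro _ ⟨⟨x, hx, rfl⟩, ⟨y, hy, hxy⟩⟩
      -- By injectivity over the faces, their images overlap only in the image of their
      -- intersection.
      obtain rfl := eq_of_mem_silhouetteFace hU hp hx hy.1 hxy.symm
      exact ⟨x, ⟨hx, hy⟩, rfl⟩
    · intro p hp
      obtain ⟨a, ha⟩ := silhouetteFace_eq_segment hU (Finset.mem_offDiag.1 hp).2.2
      rw [ha]
      refine (IsCompact.image ?_ (hyperplaneProj U).continuous).measurableSet.nullMeasurableSet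
      rw [segment_eq_image]
      exact isCompact_Icc.image (by fun_prop)
  rw [projectedSurfaceArea, show 3 - 2 = 1 from rfl, euclideanHausdorffMeasure_one, hmeas,
    ENNReal.toReal_sum (by simp)]
  simp only [ENNReal.toReal_ofReal (Real.sqrt_nonneg _)]
  have hd : (Finset.univ : Finset (Fin 3)).offDiag =
      {(0, 1), (1, 0), (0, 2), (2, 0), (1, 2), (2, 1)} := by decide
  rw [hd, Fin.sum_univ_three]
  have e1 : (-0 - 1 : Fin 3) = 2 := by decide
  have e2 : (-1 - 0 : Fin 3) = 2 := by decide
  have e3 : (-0 - 2 : Fin 3) = 1 := by decide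
  have e4 : (-2 - 0 : Fin 3) = 1 := by decide
  have e5 : (-1 - 2 : Fin 3) = 0 := by decide
  have e6 : (-2 - 1 : Fin 3) = 0 := by decide
  rw [Finset.sum_insert (by decide), Finset.sum_insert (by decide), Finset.sum_insert (by decide),
    Finset.sum_insert (by decide), Finset.sum_insert (by decide), Finset.sum_singleton]
  simp only [e1, e2, e3, e4, e5, e6]
  ring

end Perimeter

/-- Cauchy's formula, perimeter equals `π` times mean width, off the coordinate planes. -/
theorem projectedSurfaceArea_sq_ae_eq :
    (fun U : sphere (0 : EuclideanSpace ℝ (Fin 3)) 1 => projectedSurfaceArea U ^ 2)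
      =ᵐ[uniformSphere (EuclideanSpace ℝ (Fin 3))]
    fun U => Real.pi ^ 2 * projectedMeanWidth U ^ 2 := by
  filter_upwards [uniformSphere_ae_coord_ne_zero] with U hU
  have := Real.pi_pos
  rw [projectedSurfaceArea_eq hU, projectedMeanWidth_eq]
  field_simp

theorem integrable_projectedSurfaceArea_sq :
    Integrable (fun U => projectedSurfaceArea U ^ 2)
      (uniformSphere (EuclideanSpace ℝ (Fin 3))) :=
  (integrable_congr projectedSurfaceArea_sq_ae_eq).2
    ((integrable_projectedMeanWidth_pow 2).const_mul _)

theorem projectionZeta_three :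
    projectionZeta 3 = 3 * Real.pi * hyp32 (-1 / 2) (1 / 2) (3 / 2) 1 2 1 := by
  have := Real.pi_pos
  rw [projectionZeta, integral_congr_ae projectedSurfaceArea_sq_ae_eq, integral_const_mul,
    integral_projectedMeanWidth_sq]
  push_cast
  field_simp
  ring

theorem mainTheorem6 :
    -- the mean width of the shadow of the 3-cube along the unit vector `U`
    (∀ U : sphere (0 : EuclideanSpace ℝ (Fin 3)) 1,
      projectedMeanWidth U
        = 2 / Real.pi * ∑ i : Fin 3, √(1 - (U : EuclideanSpace ℝ (Fin 3)) i ^ 2)) ∧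
    -- its first moment
    Integrable (fun U => projectedMeanWidth U) (uniformSphere (EuclideanSpace ℝ (Fin 3))) ∧
    ∫ U, projectedMeanWidth U ∂(uniformSphere (EuclideanSpace ℝ (Fin 3))) = 3 / 2 ∧
    -- its second moment
    Integrable (fun U => projectedMeanWidth U ^ 2) (uniformSphere (EuclideanSpace ℝ (Fin 3))) ∧
    Summable (hyp32Term (-1 / 2) (1 / 2) (3 / 2) 1 2 1) ∧
    ∫ U, projectedMeanWidth U ^ 2 ∂(uniformSphere (EuclideanSpace ℝ (Fin 3)))
      = 2 / Real.pi ^ 2 * (4 + 3 * Real.pi * hyp32 (-1 / 2) (1 / 2) (3 / 2) 1 2 1) ∧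
    2 / Real.pi ^ 2 * (4 + 3 * Real.pi * hyp32 (-1 / 2) (1 / 2) (3 / 2) 1 2 1)
      < 1 + 4 / Real.pi ∧
    -- its extreme values
    IsGreatest (Set.range fun U : sphere (0 : EuclideanSpace ℝ (Fin 3)) 1 => projectedMeanWidth U)
      (2 * √6 / Real.pi) ∧
    IsLeast (Set.range fun U : sphere (0 : EuclideanSpace ℝ (Fin 3)) 1 => projectedMeanWidth U)
      (4 / Real.pi) ∧
    -- the constant `ζ_3`, together with the existence of the expectation that defines it
    Integrable (fun U => projectedSurfaceArea U ^ 2)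
      (uniformSphere (EuclideanSpace ℝ (Fin 3))) ∧
    projectionZeta 3 = 3 * Real.pi * hyp32 (-1 / 2) (1 / 2) (3 / 2) 1 2 1 := by

  exact ⟨projectedMeanWidth_eq, by simpa using integrable_projectedMeanWidth_pow 1,
    integral_projectedMeanWidth, integrable_projectedMeanWidth_pow 2, summable_hyp32Term,
    integral_projectedMeanWidth_sq, second_moment_lt, isGreatest_projectedMeanWidth,
    isLeast_projectedMeanWidth, integrable_projectedSurfaceArea_sq, projectionZeta_three⟩
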